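/- Let $\Theta=[0,1]$ and $r(\theta,\theta')=\min\{\theta,\theta'\}$. For a finite list of job types $\vartheta=(\theta_1,\dots,\theta_n)\in\Theta^n$, a matching is a set of pairwise disjoint two-element subsets $\{j,k\}$ of $\{1,\dots,n\}$, and $$\mathsf{OPT}(\vartheta)=\max_{M\text{ a matching}}\ \sum_{\{j,k\}\in M} r(\theta_j,\theta_k).$$ Let $\vartheta^{-j}$ denote the list with job $j$ removed, and $\vartheta^{+j}$ the list with one additional copy of job $j$. Define the marginal loss $\mathsf{ML}_j(\vartheta)=\mathsf{OPT}(\vartheta)-\mathsf{OPT}(\vartheta^{-j})$, the marginal gain $\mathsf{MG}_j(\vartheta)=\mathsf{OPT}(\vartheta^{+j})-\mathsf{OPT}(\vartheta)$, and the potential $p(\theta)=\frac12\sup_{\theta'\in\Theta}r(\theta,\theta')$, which here equals $\theta/2$. There is an absolute constant $C$ such that the following holds for every integer $n\ge 2$ and every $\theta_1\in[0,1]$. If $\theta_2,\dots,\theta_n$ are independent random variables, each uniformly distributed on $[0,1]$, and $\vartheta=(\theta_1,\theta_2,\dots,\theta_n)$, then $\mathsf{ML}_1(\vartheta)$ and $\mathsf{MG}_1(\vartheta)$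 are square-integrable and $$\bigl|\mathbb E[\mathsf{ML}_1(\vartheta)]-p(\theta_1)\bigr|\le \frac Cn,\qquad \bigl|\mathbb E[\mathsf{MG}_1(\vartheta)]-p(\theta_1)\bigr|\le \frac Cn,$$ $$\mathrm{Var}(\mathsf{ML}_1(\vartheta))=\mathrm{Var}(\mathsf{MG}_1(\vartheta))\le \frac Cn.$$ -/

import Mathlib

open MeasureTheory ProbabilityTheory

/-- A matching of the `n` jobs `Fin n`: a set of pairs `(j, k)` with `j < k` (each unordered pair is
recorded once, in increasing order) such that every job lies in at most one pair. -/
def IsJobMatching {n : ℕ} (M : Finset (Fin n × Fin n)) : Prop :=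
  (∀ e ∈ M, e.1 < e.2) ∧ ∀ j : Fin n, (M.filter (fun e => e.1 = j ∨ e.2 = j)).card ≤ 1

theorem isJobMatching_empty {n : ℕ} : IsJobMatching (∅ : Finset (Fin n × Fin n)) := by
  simp [IsJobMatching]

/-- The total reward of the pairs in `M`; unmatched jobs contribute zero. -/
def matchingReward {Θ : Type*} (r : Θ → Θ → ℝ) {n : ℕ} (θ : Fin n → Θ)
    (M : Finset (Fin n × Fin n)) : ℝ :=
  ∑ e ∈ M, r (θ e.1) (θ e.2)

open Classical in
/-- The offline optimum `OPT(θ)`: the maximum total reward of a matching of the jobs. -/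
noncomputable def offlineOPT {Θ : Type*} (r : Θ → Θ → ℝ) {n : ℕ} (θ : Fin n → Θ) : ℝ :=
  (Finset.univ.filter (fun M : Finset (Fin n × Fin n) => IsJobMatching M)).sup'
    ⟨∅, by simp [isJobMatching_empty]⟩ (matchingReward r θ)

/-- The instance in which job `j` is not present. -/
def removeJob {Θ : Type*} {n : ℕ} (θ : Fin (n + 1) → Θ) (j : Fin (n + 1)) : Fin n → Θ :=
  fun i => θ (j.succAbove i)

/-- The instance in which an additional copy of job `j` is present (in the first position). -/
def duplicateJob {Θ : Type*} {n : ℕ} (θ : Fin n → Θ) (j : Fin n) : Fin (n + 1) → Θ :=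
  Fin.cons (θ j) θ

/-- The marginal loss of job `j`: `OPT(θ) - OPT(θ⁻ʲ)`. -/
noncomputable def marginalLoss {Θ : Type*} (r : Θ → Θ → ℝ) {n : ℕ} (θ : Fin (n + 1) → Θ)
    (j : Fin (n + 1)) : ℝ :=
  offlineOPT r θ - offlineOPT r (removeJob θ j)

/-- The marginal gain of job `j`: `OPT(θ⁺ʲ) - OPT(θ)`. -/
noncomputable def marginalGain {Θ : Type*} (r : Θ → Θ → ℝ) {n : ℕ} (θ : Fin n → Θ)
    (j : Fin n) : ℝ :=
  offlineOPT r (duplicateJob θ j) - offlineOPT r θ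

/-- The potential of a job type: half the highest reward of a match with it. -/
noncomputable def potential {Θ : Type*} (r : Θ → Θ → ℝ) (t : Θ) : ℝ :=
  (⨆ t' : Θ, r t t') / 2

/-- The pooling reward `min {t, t'}` on the type space `[0, 1]`. -/
def minReward (t t' : unitInterval) : ℝ :=
  min (t : ℝ) (t' : ℝ)

/-- The instance whose first job has type `t₁` and whose other jobs have the types in `x`. -/
def withFirstJob {Θ : Type*} {m : ℕ} (t₁ : Θ) (x : Fin m → Θ) : Fin (m + 1) → Θ :=
  Fin.cons t₁ x

/-!
For the reward `min`, the optimal matching pairs the jobs greedily from the highest type downwards.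
By the layer-cake formula its value is `∫ t in 0..1, ⌊N t / 2⌋`, where `N t` is the number of jobs
of type above the level `t`: a matching of reward `min θ_j θ_k` per pair contributes at level `t` the
number of its pairs with both jobs above `t`, at most `⌊N t / 2⌋`, and the greedy matching attains
this at every level (`offlineOPT_minReward`). Since `⌊N / 2⌋ = N / 2 - 1 / 4 + (-1) ^ N / 4`, the
optimum is `(∑ i, θ i) / 2 - 1 / 4` plus a quarter of the integral over `[0, 1]` of the parity sign
`(-1) ^ N t = ∏ i, levelSign t (θ i)`.

An additional job of type `t₁` flips this sign exactly at the levels below `t₁`. With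
`D = ∫ t in 0..t₁, ∏ i, levelSign t (x i)` (`parityIntegral`) for the other jobs `x`, the marginal
loss is therefore `t₁ / 2 - D / 2` and the marginal gain is `t₁ / 2 + D / 2`
(`marginalLoss_withFirstJob`, `marginalGain_withFirstJob`). In particular the two variances agree.

For `m` independent uniform types the product structure of the sign gives
`𝔼 D = ∫ t in 0..t₁, (2 t - 1) ^ m` and
`𝔼 D² = ∫ t in 0..t₁, ∫ u in 0..t₁, (1 - 2 |t - u|) ^ m`
(`integral_parityIntegral`, `integral_sq_parityIntegral`), which are in absolute value at most
`1 / (m + 1)` and `2 / (m + 1)`. The constant `C = 1 / 2` results.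
-/

/-! ### Level signs -/

/-- The sign `-1` if `a` lies strictly above the level `t`, and `1` otherwise. The product over a list
of jobs is the parity sign of the number of jobs above `t`. -/
noncomputable def levelSign (t : ℝ) (a : unitInterval) : ℝ :=
  if t < (a : ℝ) then -1 else 1

theorem levelSign_of_lt {t : ℝ} {a : unitInterval} (h : t < a) : levelSign t a = -1 := by
  simp [levelSign, h]

theorem levelSign_of_le {t : ℝ} {a : unitInterval} (h : (a : ℝ) ≤ t) : levelSign t a = 1 := by
  simp [levelSign, h]

theorem abs_levelSign (t : ℝ) (a : unitInterval) : |levelSign t a| = 1 := by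
  unfold levelSign; split_ifs <;> norm_num

theorem measurable_levelSign : Measurable fun p : ℝ × unitInterval => levelSign p.1 p.2 :=
  Measurable.ite (measurableSet_lt measurable_fst (measurable_subtype_coe.comp measurable_snd))
    measurable_const measurable_const

theorem abs_prod_levelSign {ι : Type*} (S : Finset ι) (θ : ι → unitInterval) (t : ℝ) :
    |∏ i ∈ S, levelSign t (θ i)| = 1 := by
  rw [Finset.abs_prod]
  simp [abs_levelSign]

theorem unitInterval_coe_min (a b : unitInterval) :
    ((min a b : unitInterval) : ℝ) = min (a : ℝ) b :=
  Monotone.map_min (f := fun a : unitInterval => (a : ℝ)) fun _ _ h => h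

theorem intervalIntegrable_prod_levelSign {ι : Type*} (S : Finset ι) (θ : ι → unitInterval)
    (a b : ℝ) : IntervalIntegrable (fun t => ∏ i ∈ S, levelSign t (θ i)) volume a b := by
  refine (intervalIntegrable_const (c := (1 : ℝ))).mono_fun ?_ ?_
  · refine (Finset.measurable_prod S fun i _ => ?_).aestronglyMeasurable
    exact measurable_levelSign.comp (measurable_id.prodMk measurable_const)
  · exact Filter.Eventually.of_forall fun t => by
      simp only [Real.norm_eq_abs, abs_prod_levelSign, abs_one, le_refl]

theorem intervalIntegrable_levelSign (s : unitInterval) (a b : ℝ) :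
    IntervalIntegrable (fun t => levelSign t s) volume a b := by
  simpa using intervalIntegrable_prod_levelSign {()} (fun _ => s) a b

/-- A sign flip below the level `s` changes an integral over `[0, 1]` by its part over `[0, s]`. -/
theorem integral_levelSign_mul (s : unitInterval) {f : ℝ → ℝ}
    (hf : ∀ a b, IntervalIntegrable f volume a b) :
    ∫ t in (0 : ℝ)..1, levelSign t s * f t =
      (∫ t in (0 : ℝ)..1, f t) - 2 * ∫ t in (0 : ℝ)..s, f t := by
  have h0 : Set.EqOn (fun t => -f t) (fun t => levelSign t s * f t) (Set.Ioo (0 : ℝ) s) :=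
    fun t ht => by simp [levelSign_of_lt ht.2]
  have h1 : Set.EqOn f (fun t => levelSign t s * f t) (Set.Ioo (s : ℝ) 1) :=
    fun t ht => by simp [levelSign_of_le ht.1.le]
  have i0 : IntervalIntegrable (fun t => levelSign t s * f t) volume 0 s :=
    (hf 0 s).neg.congr_uIoo (by rw [Set.uIoo_of_le s.2.1]; exact h0)
  have i1 : IntervalIntegrable (fun t => levelSign t s * f t) volume s 1 :=
    (hf s 1).congr_uIoo (by rw [Set.uIoo_of_le s.2.2]; exact h1)
  rw [← intervalIntegral.integral_add_adjacent_intervals i0 i1,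
    ← intervalIntegral.integral_add_adjacent_intervals (hf 0 s) (hf s 1),
    ← intervalIntegral.integral_congr_Ioo_of_le s.2.1 h0,
    ← intervalIntegral.integral_congr_Ioo_of_le s.2.2 h1, intervalIntegral.integral_neg]
  ring

theorem integral_levelSign (s : unitInterval) :
    ∫ t in (0 : ℝ)..1, levelSign t s = 1 - 2 * (s : ℝ) := by
  simpa using integral_levelSign_mul s (f := fun _ => 1) fun a b => intervalIntegrable_const

/-! ### The offline optimum as a layer-cake integral -/

/-- The number of disjoint pairs that can be formed from the jobs of `S` above the level `t`,
integrated over the levels `t ∈ [0, 1]`: if `N` is the number of these jobs, then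
`⌊N / 2⌋ = N / 2 - 1 / 4 + (-1) ^ N / 4`. -/
noncomputable def layerValue {ι : Type*} (S : Finset ι) (θ : ι → unitInterval) : ℝ :=
  (∑ i ∈ S, (θ i : ℝ)) / 2 - 1 / 4 + (∫ t in (0 : ℝ)..1, ∏ i ∈ S, levelSign t (θ i)) / 4

/-- The right-hand side is `⌊N / 2⌋`. -/
theorem cast_le_half_add_parity_of_two_mul_le {k N : ℕ} (h : 2 * k ≤ N) :
    (k : ℝ) ≤ (N : ℝ) / 2 - 1 / 4 + (-1) ^ N / 4 := by
  rcases Nat.even_or_odd N with hN | hN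
  · rw [hN.neg_one_pow]
    have : (2 * k : ℝ) ≤ N := by exact_mod_cast h
    linarith
  · rw [hN.neg_one_pow]
    have h' : 2 * k + 1 ≤ N := by obtain ⟨l, rfl⟩ := hN; omega
    have : (2 * k + 1 : ℝ) ≤ N := by exact_mod_cast h'
    linarith

theorem IsJobMatching.eq_of_mem {n : ℕ} {M : Finset (Fin n × Fin n)} (hM : IsJobMatching M)
    {e f : Fin n × Fin n} (he : e ∈ M) (hf : f ∈ M) {j : Fin n} (hej : e.1 = j ∨ e.2 = j)
    (hfj : f.1 = j ∨ f.2 = j) : e = f :=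
  Finset.card_le_one.1 (hM.2 j) e (by simp [he, hej]) f (by simp [hf, hfj])

/-- The pairs of a matching with both jobs satisfying `p` use up twice as many jobs with `p`. -/
theorem IsJobMatching.two_mul_card_le {n : ℕ} {M : Finset (Fin n × Fin n)}
    (hM : IsJobMatching M) (p : Fin n → Prop) [DecidablePred p] :
    2 * (M.filter fun e => p e.1 ∧ p e.2).card ≤ (Finset.univ.filter p).card := by
  have hcard : ((M.filter fun e => p e.1 ∧ p e.2).biUnion
      fun e => ({e.1, e.2} : Finset (Fin n))).card =
      2 * (M.filter fun e => p e.1 ∧ p e.2).card := by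
    rw [Finset.card_biUnion]
    · rw [Finset.sum_congr rfl (g := fun _ => 2), Finset.sum_const, smul_eq_mul, mul_comm]
      intro e he
      exact Finset.card_pair (hM.1 e (Finset.mem_filter.1 he).1).ne
    · intro e he f hf hef
      rw [Function.onFun, Finset.disjoint_left]
      intro j hj hj'
      simp only [Finset.mem_insert, Finset.mem_singleton] at hj hj'
      exact hef (hM.eq_of_mem (Finset.mem_filter.1 he).1 (Finset.mem_filter.1 hf).1
        (hj.imp Eq.symm Eq.symm) (hj'.imp Eq.symm Eq.symm))
  rw [← hcard]
  refine Finset.card_le_card fun j hj => ?_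
  simp only [Finset.mem_biUnion, Finset.mem_filter, Finset.mem_insert,
    Finset.mem_singleton] at hj
  obtain ⟨e, ⟨-, h1, h2⟩, rfl | rfl⟩ := hj <;> simpa

theorem integral_one_sub_levelSign (s : unitInterval) :
    ∫ t in (0 : ℝ)..1, (1 - levelSign t s) / 2 = (s : ℝ) := by
  rw [intervalIntegral.integral_div, intervalIntegral.integral_sub intervalIntegrable_const
    (intervalIntegrable_levelSign s 0 1), integral_levelSign]
  simp

theorem intervalIntegrable_one_sub_levelSign (s : unitInterval) (a b : ℝ) :
    IntervalIntegrable (fun t => (1 - levelSign t s) / 2) volume a b :=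
  (intervalIntegrable_const.sub (intervalIntegrable_levelSign s a b)).div_const 2

theorem one_sub_levelSign (t : ℝ) (s : unitInterval) :
    (1 - levelSign t s) / 2 = if t < (s : ℝ) then 1 else 0 := by
  unfold levelSign; split_ifs <;> norm_num

/-- No matching beats the layer value: at every level `t` its pairs with both jobs above `t` are
disjoint pairs of jobs above `t`. -/
theorem IsJobMatching.matchingReward_le {n : ℕ} {M : Finset (Fin n × Fin n)}
    (hM : IsJobMatching M) (θ : Fin n → unitInterval) :
    matchingReward minReward θ M ≤ layerValue Finset.univ θ := by
  have hleft : matchingReward minReward θ M =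
      ∫ t in (0 : ℝ)..1, ∑ e ∈ M, (1 - levelSign t (min (θ e.1) (θ e.2))) / 2 := by
    rw [intervalIntegral.integral_finsetSum fun e _ =>
      intervalIntegrable_one_sub_levelSign _ 0 1]
    refine Finset.sum_congr rfl fun e _ => ?_
    rw [integral_one_sub_levelSign, minReward]
    exact (unitInterval_coe_min _ _).symm
  have isum : IntervalIntegrable (fun t => ∑ i, (1 - levelSign t (θ i)) / 2) volume 0 1 := by
    simpa [Finset.sum_fn] using IntervalIntegrable.sum (Finset.univ)
      fun i _ => intervalIntegrable_one_sub_levelSign (θ i) 0 1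
  have isumM : IntervalIntegrable
      (fun t => ∑ e ∈ M, (1 - levelSign t (min (θ e.1) (θ e.2))) / 2) volume 0 1 := by
    simpa [Finset.sum_fn] using IntervalIntegrable.sum M
      fun e _ => intervalIntegrable_one_sub_levelSign (min (θ e.1) (θ e.2)) 0 1
  have iprod := intervalIntegrable_prod_levelSign Finset.univ θ 0 1
  have hright : layerValue Finset.univ θ = ∫ t in (0 : ℝ)..1,
      ((∑ i, (1 - levelSign t (θ i)) / 2) / 2 - 1 / 4 + (∏ i, levelSign t (θ i)) / 4) := by
    rw [intervalIntegral.integral_add ((isum.div_const 2).sub intervalIntegrable_const)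
      (iprod.div_const 4), intervalIntegral.integral_sub (isum.div_const 2)
      intervalIntegrable_const, intervalIntegral.integral_div, intervalIntegral.integral_div,
      intervalIntegral.integral_finsetSum fun i _ => intervalIntegrable_one_sub_levelSign _ 0 1]
    simp only [integral_one_sub_levelSign, layerValue]
    simp
  rw [hleft, hright]
  refine intervalIntegral.integral_mono_on zero_le_one isumM
    (((isum.div_const 2).sub intervalIntegrable_const).add (iprod.div_const 4)) fun t _ => ?_
  have h := cast_le_half_add_parity_of_two_mul_le (hM.two_mul_card_le fun i => t < (θ i : ℝ))
  simp only [one_sub_levelSign, Finset.sum_boole]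
  simp only [levelSign, Finset.prod_ite, Finset.prod_const, one_pow, mul_one]
  simpa only [unitInterval_coe_min, lt_min_iff] using h

/-- The greedy matching, which pairs the two highest remaining jobs, attains the layer value. -/
theorem exists_isJobMatching_matchingReward_eq {n : ℕ} (θ : Fin n → unitInterval)
    (S : Finset (Fin n)) :
    ∃ M : Finset (Fin n × Fin n), IsJobMatching M ∧ (∀ e ∈ M, e.1 ∈ S ∧ e.2 ∈ S) ∧
      matchingReward minReward θ M = layerValue S θ := by
  induction S using Finset.strongInduction with
  | H S ih =>
  rcases S.eq_empty_or_nonempty with rfl | hS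
  · exact ⟨∅, isJobMatching_empty, by simp, by simp [matchingReward, layerValue]⟩
  obtain ⟨a, ha, hamax⟩ := S.exists_max_image θ hS
  rcases (S.erase a).eq_empty_or_nonempty with h1 | hS'
  · refine ⟨∅, isJobMatching_empty, by simp, ?_⟩
    have : S = {a} := by rw [← Finset.insert_erase ha, h1]; rfl
    subst this
    simp [matchingReward, layerValue, integral_levelSign]
    ring
  obtain ⟨b, hb, hbmax⟩ := (S.erase a).exists_max_image θ hS'
  have hba : b ≠ a := Finset.ne_of_mem_erase hb
  have hbS : b ∈ S := Finset.mem_of_mem_erase hb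
  set T := (S.erase a).erase b with hT
  have haT : a ∉ T := by simp [hT]
  have hbT : b ∉ T := by simp [hT]
  have hTS : T ⊆ S := (Finset.erase_subset _ _).trans (Finset.erase_subset _ _)
  obtain ⟨M, hM, hMT, hMr⟩ := ih T
    (Finset.ssubset_iff_subset_ne.2 ⟨hTS, fun h => haT (h ▸ ha)⟩)
  have hsplit : ∀ g : Fin n → ℝ, ∏ i ∈ S, g i = g a * (g b * ∏ i ∈ T, g i) := fun g => by
    rw [hT, Finset.mul_prod_erase _ _ hb, Finset.mul_prod_erase _ _ ha]
  have hsum : ∑ i ∈ S, (θ i : ℝ) = θ a + (θ b + ∑ i ∈ T, (θ i : ℝ)) := by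
    rw [hT, Finset.add_sum_erase _ (fun i => (θ i : ℝ)) hb,
      Finset.add_sum_erase _ (fun i => (θ i : ℝ)) ha]
  -- Below the level of `b` the signs of `a` and `b` cancel; from it on no job of `T` is above `t`.
  have hprod : ∀ t : ℝ, ∏ i ∈ S, levelSign t (θ i) =
      (∏ i ∈ T, levelSign t (θ i)) + (levelSign t (θ a) - levelSign t (θ b)) := fun t => by
    have hab : (θ b : ℝ) ≤ θ a := hamax b hbS
    rw [hsplit]
    rcases lt_or_ge t (θ b : ℝ) with h | h
    · simp [levelSign_of_lt h, levelSign_of_lt (h.trans_le hab)]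
    · have : ∏ i ∈ T, levelSign t (θ i) = 1 := Finset.prod_eq_one fun i hi =>
        levelSign_of_le ((show (θ i : ℝ) ≤ θ b from hbmax i (Finset.mem_of_mem_erase hi)).trans h)
      simp [levelSign_of_le h, this]
  have hval : layerValue S θ = θ b + layerValue T θ := by
    unfold layerValue
    simp_rw [hprod]
    rw [intervalIntegral.integral_add (intervalIntegrable_prod_levelSign T θ 0 1)
      ((intervalIntegrable_levelSign _ 0 1).sub (intervalIntegrable_levelSign _ 0 1)),
      intervalIntegral.integral_sub (intervalIntegrable_levelSign _ 0 1)
      (intervalIntegrable_levelSign _ 0 1), integral_levelSign, integral_levelSign, hsum]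
    ring
  -- The new pair `{a, b}`, recorded in increasing order.
  obtain ⟨p, hlt, hp⟩ : ∃ p : Fin n × Fin n, p.1 < p.2 ∧ (p = (a, b) ∨ p = (b, a)) := by
    rcases lt_or_gt_of_ne hba with h | h
    · exact ⟨(b, a), h, Or.inr rfl⟩
    · exact ⟨(a, b), h, Or.inl rfl⟩
  have hpT : ∀ j, (p.1 = j ∨ p.2 = j) → j ∉ T := by
    rcases hp with rfl | rfl <;> rintro j (rfl | rfl) <;> assumption
  have hpM : p ∉ M := fun h => hpT p.1 (Or.inl rfl) (hMT p h).1
  refine ⟨insert p M, ⟨?_, fun j => ?_⟩, ?_, ?_⟩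
  · intro e he
    rcases Finset.mem_insert.1 he with rfl | he
    exacts [hlt, hM.1 e he]
  · rw [Finset.filter_insert]
    split_ifs with h
    · rw [Finset.filter_eq_empty_iff.2]
      · simp
      · rintro e he (rfl | rfl)
        exacts [hpT _ h (hMT e he).1, hpT _ h (hMT e he).2]
    · exact hM.2 j
  · intro e he
    rcases Finset.mem_insert.1 he with rfl | he
    · rcases hp with rfl | rfl <;> simp [ha, hbS]
    · exact ⟨hTS (hMT e he).1, hTS (hMT e he).2⟩
  · have hpr : minReward (θ p.1) (θ p.2) = θ b := by
      have hab : (θ b : ℝ) ≤ θ a := hamax b hbS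
      rcases hp with rfl | rfl <;> simp [minReward, hab]
    rw [hval, ← hMr, matchingReward, Finset.sum_insert hpM, hpr, matchingReward]

theorem offlineOPT_minReward {n : ℕ} (θ : Fin n → unitInterval) :
    offlineOPT minReward θ = layerValue Finset.univ θ := by
  classical
  refine le_antisymm (Finset.sup'_le _ _ fun M hM => ?_) ?_
  · exact IsJobMatching.matchingReward_le (by simpa using hM) θ
  · obtain ⟨M, hM, -, hr⟩ := exists_isJobMatching_matchingReward_eq θ Finset.univ
    rw [← hr]
    exact Finset.le_sup' (matchingReward minReward θ) (by simpa using hM)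

/-! ### Marginal loss and gain -/

/-- The integral over the levels below `s` of the parity sign of the number of jobs above the
level. -/
noncomputable def parityIntegral {m : ℕ} (s : ℝ) (x : Fin m → unitInterval) : ℝ :=
  ∫ t in (0 : ℝ)..s, ∏ i, levelSign t (x i)

theorem offlineOPT_withFirstJob {m : ℕ} (t₁ : unitInterval) (x : Fin m → unitInterval) :
    offlineOPT minReward (withFirstJob t₁ x) =
      offlineOPT minReward x + (t₁ : ℝ) / 2 - parityIntegral t₁ x / 2 := by
  simp only [offlineOPT_minReward, layerValue, withFirstJob, Fin.sum_univ_succ,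
    Fin.prod_univ_succ, Fin.cons_zero, Fin.cons_succ, parityIntegral]
  rw [integral_levelSign_mul t₁ (intervalIntegrable_prod_levelSign _ _)]
  ring

theorem marginalLoss_withFirstJob {m : ℕ} (t₁ : unitInterval) (x : Fin m → unitInterval) :
    marginalLoss minReward (withFirstJob t₁ x) 0 = (t₁ : ℝ) / 2 - parityIntegral t₁ x / 2 := by
  have : removeJob (withFirstJob t₁ x) 0 = x := by
    ext i; simp [removeJob, withFirstJob]
  rw [marginalLoss, this, offlineOPT_withFirstJob]
  ring

theorem marginalGain_withFirstJob {m : ℕ} (t₁ : unitInterval) (x : Fin m → unitInterval) :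
    marginalGain minReward (withFirstJob t₁ x) 0 = (t₁ : ℝ) / 2 + parityIntegral t₁ x / 2 := by
  have hdup : duplicateJob (withFirstJob t₁ x) 0 = withFirstJob t₁ (withFirstJob t₁ x) := by
    simp [duplicateJob, withFirstJob]
  -- The first job lies above all levels below `t₁`, so it flips the sign at each of them.
  have hneg : parityIntegral t₁ (withFirstJob t₁ x) = -parityIntegral t₁ x := by
    rw [parityIntegral, parityIntegral, ← intervalIntegral.integral_neg]
    refine intervalIntegral.integral_congr_Ioo_of_le t₁.2.1 fun t ht => ?_
    simp [withFirstJob, Fin.prod_univ_succ, levelSign_of_lt ht.2]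
  rw [marginalGain, hdup, offlineOPT_withFirstJob t₁ (withFirstJob t₁ x), hneg]
  ring

/-! ### Moments of the parity integral for uniform types -/

theorem integral_sign_eq {α : Type*} [MeasurableSpace α] (μ : Measure α) [IsProbabilityMeasure μ]
    {s : Set α} (hs : MeasurableSet s) [DecidablePred (· ∈ s)] :
    ∫ x, (if x ∈ s then (-1 : ℝ) else 1) ∂μ = 1 - 2 * μ.real s := by
  have h : (fun x => if x ∈ s then (-1 : ℝ) else 1) =
      fun x => 1 - 2 * s.indicator (fun _ => (1 : ℝ)) x := by
    ext x; by_cases hx : x ∈ s <;> simp [hx]; norm_num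
  rw [h, integral_sub (integrable_const _)
    (((integrable_const (1 : ℝ)).indicator hs).const_mul 2), integral_const_mul,
    integral_indicator hs]
  simp

theorem integral_volume_levelSign {t : ℝ} (ht : t ∈ Set.Icc (0 : ℝ) 1) :
    ∫ a, levelSign t a = 2 * t - 1 := by
  classical
  have h := integral_sign_eq (volume : Measure unitInterval)
    (measurableSet_Ioi (a := (⟨t, ht⟩ : unitInterval)))
  have hv : (volume : Measure unitInterval).real (Set.Ioi ⟨t, ht⟩) = 1 - t := by
    rw [Measure.real, unitInterval.volume_Ioi, ENNReal.toReal_ofReal (by simpa using ht.2)]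
  rw [hv] at h
  simp only [Set.mem_Ioi, ← Subtype.coe_lt_coe] at h
  simp only [levelSign]
  rw [h]
  ring

/-- The product of the signs at two levels is `-1` exactly when the job lies between the levels. -/
theorem integral_volume_levelSign_mul {t u : ℝ} (ht : t ∈ Set.Icc (0 : ℝ) 1)
    (hu : u ∈ Set.Icc (0 : ℝ) 1) :
    ∫ a, levelSign t a * levelSign u a = 1 - 2 * |t - u| := by
  classical
  wlog htu : t ≤ u generalizing t u
  · simp_rw [mul_comm (levelSign t _), abs_sub_comm t]
    exact this hu ht (le_of_not_ge htu)
  have h := integral_sign_eq (volume : Measure unitInterval)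
    (measurableSet_Ioc (a := (⟨t, ht⟩ : unitInterval)) (b := ⟨u, hu⟩))
  have hv : (volume : Measure unitInterval).real (Set.Ioc ⟨t, ht⟩ ⟨u, hu⟩) = |t - u| := by
    rw [Measure.real, unitInterval.volume_Ioc, ENNReal.toReal_ofReal (by simpa using htu),
      abs_sub_comm, abs_of_nonneg (by linarith)]
  rw [hv] at h
  rw [← h]
  congr 1 with a
  simp only [Set.mem_Ioc, ← Subtype.coe_lt_coe, ← Subtype.coe_le_coe, levelSign]
  rcases lt_or_ge t (a : ℝ) with h1 | h1 <;> rcases lt_or_ge u (a : ℝ) with h2 | h2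
  · simp [h1, h2]
  · simp [h1, h2, not_lt.2 h2]
  · exact absurd (h2.trans_le h1) (not_lt.2 htu)
  · simp [not_lt.2 h1, not_lt.2 h2]

theorem measurable_prod_levelSign (m : ℕ) :
    Measurable fun p : (Fin m → unitInterval) × ℝ => ∏ i, levelSign p.2 (p.1 i) :=
  Finset.measurable_prod _ fun i _ => measurable_levelSign.comp
    (measurable_snd.prodMk ((measurable_pi_apply i).comp measurable_fst))

theorem measurable_parityIntegral (m : ℕ) {s : ℝ} (hs : 0 ≤ s) :
    Measurable fun x : Fin m → unitInterval => parityIntegral s x := by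
  simp only [parityIntegral, intervalIntegral.integral_of_le hs]
  exact (measurable_prod_levelSign m).stronglyMeasurable.integral_prod_right.measurable

theorem abs_parityIntegral_le {m : ℕ} (t₁ : unitInterval) (x : Fin m → unitInterval) :
    |parityIntegral t₁ x| ≤ 1 := by
  have h := intervalIntegral.norm_integral_le_of_norm_le_const (a := 0) (b := (t₁ : ℝ)) (C := 1)
    (f := fun t => ∏ i, levelSign t (x i)) fun t _ => (abs_prod_levelSign _ _ _).le
  rw [sub_zero, abs_of_nonneg t₁.2.1, one_mul] at h
  exact h.trans t₁.2.2

theorem integral_parityIntegral (m : ℕ) (t₁ : unitInterval) :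
    ∫ x : Fin m → unitInterval, parityIntegral t₁ x = ∫ t in (0 : ℝ)..t₁, (2 * t - 1) ^ m := by
  simp only [parityIntegral, intervalIntegral.integral_of_le t₁.2.1]
  rw [integral_integral_swap]
  · refine setIntegral_congr_fun measurableSet_Ioc fun t ht => ?_
    have ht' : t ∈ Set.Icc (0 : ℝ) 1 := ⟨ht.1.le, ht.2.trans t₁.2.2⟩
    rw [integral_fintype_prod_volume_eq_prod fun _ : Fin m => levelSign t]
    simp [integral_volume_levelSign ht']
  · refine Integrable.of_bound (measurable_prod_levelSign m).aestronglyMeasurable 1 ?_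
    exact Filter.Eventually.of_forall fun p => (abs_prod_levelSign _ _ _).le

/-- The square is written as a double integral over pairs of levels, so that after exchanging the
order of integration the expectation factors over the jobs. -/
theorem integral_sq_parityIntegral (m : ℕ) (t₁ : unitInterval) :
    ∫ x : Fin m → unitInterval, parityIntegral t₁ x ^ 2 =
      ∫ t in (0 : ℝ)..t₁, ∫ u in (0 : ℝ)..t₁, (1 - 2 * |t - u|) ^ m := by
  simp only [parityIntegral, intervalIntegral.integral_of_le t₁.2.1]
  set μ : Measure ℝ := volume.restrict (Set.Ioc 0 (t₁ : ℝ)) with hμ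
  have hsq : ∀ x : Fin m → unitInterval, (∫ t, ∏ i, levelSign t (x i) ∂μ) ^ 2 =
      ∫ p, (∏ i, levelSign p.1 (x i)) * ∏ i, levelSign p.2 (x i) ∂(μ.prod μ) := fun x => by
    rw [sq, integral_prod_mul (fun t => ∏ i, levelSign t (x i)) fun t => ∏ i, levelSign t (x i)]
  have hmeas : Measurable fun q : (Fin m → unitInterval) × (ℝ × ℝ) =>
      (∏ i, levelSign q.2.1 (q.1 i)) * ∏ i, levelSign q.2.2 (q.1 i) :=
    ((measurable_prod_levelSign m).comp
      (measurable_fst.prodMk (measurable_fst.comp measurable_snd))).mul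
    ((measurable_prod_levelSign m).comp
      (measurable_fst.prodMk (measurable_snd.comp measurable_snd)))
  simp only [hsq]
  rw [integral_integral_swap, integral_prod]
  · refine setIntegral_congr_fun measurableSet_Ioc fun t ht => ?_
    refine setIntegral_congr_fun measurableSet_Ioc fun u hu => ?_
    have ht' : t ∈ Set.Icc (0 : ℝ) 1 := ⟨ht.1.le, ht.2.trans t₁.2.2⟩
    have hu' : u ∈ Set.Icc (0 : ℝ) 1 := ⟨hu.1.le, hu.2.trans t₁.2.2⟩
    simp only [← Finset.prod_mul_distrib]
    rw [integral_fintype_prod_volume_eq_prod fun _ : Fin m =>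
      fun a => levelSign t a * levelSign u a]
    simp [integral_volume_levelSign_mul ht' hu']
  · refine Integrable.of_bound (C := 1)
      hmeas.stronglyMeasurable.integral_prod_left.aestronglyMeasurable ?_
    refine Filter.Eventually.of_forall fun p => ?_
    refine (norm_integral_le_of_norm_le_const (C := 1) ?_).trans (by simp)
    exact Filter.Eventually.of_forall fun x => by
      simp only [Real.norm_eq_abs, abs_mul, abs_prod_levelSign, mul_one, le_refl]
  · refine Integrable.of_bound hmeas.aestronglyMeasurable 1 ?_
    exact Filter.Eventually.of_forall fun q => by
      simp only [Function.uncurry, Real.norm_eq_abs, abs_mul, abs_prod_levelSign, mul_one, le_refl]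

/-! ### Bounds of order `1 / (m + 1)` -/

theorem integral_two_mul_sub_one_pow (m : ℕ) (a b : ℝ) :
    ∫ t in a..b, (2 * t - 1) ^ m =
      ((2 * b - 1) ^ (m + 1) - (2 * a - 1) ^ (m + 1)) / (2 * (m + 1)) := by
  rw [intervalIntegral.integral_comp_mul_sub (fun t => t ^ m) two_ne_zero, integral_pow]
  simp only [smul_eq_mul]
  field_simp

/-- The powers of `2 t - 1` concentrate at the two ends of `[0, 1]`. -/
theorem abs_integral_two_mul_sub_one_pow_le (m : ℕ) {a b : ℝ} (ha : a ∈ Set.Icc (0 : ℝ) 1)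
    (hb : b ∈ Set.Icc (0 : ℝ) 1) : |∫ t in a..b, (2 * t - 1) ^ m| ≤ 1 / (m + 1) := by
  have hpow : ∀ {c : ℝ}, c ∈ Set.Icc (0 : ℝ) 1 → |(2 * c - 1) ^ (m + 1)| ≤ 1 := fun hc => by
    rw [abs_pow]
    exact pow_le_one₀ (abs_nonneg _) (abs_le.2 ⟨by linarith [hc.1], by linarith [hc.2]⟩)
  have hm : (0 : ℝ) < m + 1 := by positivity
  rw [integral_two_mul_sub_one_pow, abs_div, abs_of_pos (by positivity : (0 : ℝ) < 2 * (m + 1)),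
    div_le_div_iff₀ (by positivity) hm]
  have := abs_sub ((2 * b - 1) ^ (m + 1)) ((2 * a - 1) ^ (m + 1))
  nlinarith [hpow ha, hpow hb]

/-- Split at `u = t`; on each side the integrand is, after an affine substitution, `(2 v - 1) ^ m`
on a subinterval of `[0, 1]`. -/
theorem abs_integral_one_sub_two_mul_abs_pow_le (m : ℕ) (t₁ : unitInterval) {t : ℝ}
    (ht : t ∈ Set.Icc (0 : ℝ) t₁) :
    |∫ u in (0 : ℝ)..t₁, (1 - 2 * |t - u|) ^ m| ≤ 2 / (m + 1) := by
  have hc : Continuous fun u : ℝ => (1 - 2 * |t - u|) ^ m := by fun_prop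
  have ht1 : (t₁ : ℝ) ≤ 1 := t₁.2.2
  have h0 : ∫ u in (0 : ℝ)..t, (1 - 2 * |t - u|) ^ m =
      ∫ v in (1 - t)..1, (2 * v - 1) ^ m := by
    have := intervalIntegral.integral_comp_add_right (a := 0) (b := t)
      (fun v : ℝ => (2 * v - 1) ^ m) (1 - t)
    rw [zero_add, add_sub_cancel] at this
    rw [← this]
    refine intervalIntegral.integral_congr_Ioo_of_le ht.1 fun u hu => ?_
    rw [abs_of_nonneg (by linarith [hu.2])]
    ring
  have h1 : ∫ u in t..(t₁ : ℝ), (1 - 2 * |t - u|) ^ m =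
      ∫ v in (1 + t - t₁)..1, (2 * v - 1) ^ m := by
    have := intervalIntegral.integral_comp_sub_left (a := t) (b := (t₁ : ℝ))
      (fun v : ℝ => (2 * v - 1) ^ m) (1 + t)
    rw [add_sub_cancel_right] at this
    rw [← this]
    refine intervalIntegral.integral_congr_Ioo_of_le ht.2 fun u hu => ?_
    rw [abs_of_nonpos (by linarith [hu.1])]
    ring
  rw [← intervalIntegral.integral_add_adjacent_intervals (hc.intervalIntegrable 0 t)
    (hc.intervalIntegrable t t₁), h0, h1]
  have e0 := abs_integral_two_mul_sub_one_pow_le m (a := 1 - t) (b := 1)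
    ⟨by linarith [ht.2], by linarith [ht.1]⟩ ⟨zero_le_one, le_rfl⟩
  have e1 := abs_integral_two_mul_sub_one_pow_le m (a := 1 + t - t₁) (b := 1)
    ⟨by linarith [ht.1], by linarith [ht.2]⟩ ⟨zero_le_one, le_rfl⟩
  refine (abs_add_le _ _).trans ((add_le_add e0 e1).trans_eq ?_)
  ring

theorem abs_integral_parityIntegral_le (m : ℕ) (t₁ : unitInterval) :
    |∫ x : Fin m → unitInterval, parityIntegral t₁ x| ≤ 1 / (m + 1) := by
  rw [integral_parityIntegral]
  exact abs_integral_two_mul_sub_one_pow_le m ⟨le_rfl, zero_le_one⟩ t₁.2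

theorem integral_sq_parityIntegral_le (m : ℕ) (t₁ : unitInterval) :
    ∫ x : Fin m → unitInterval, parityIntegral t₁ x ^ 2 ≤ 2 / (m + 1) := by
  rw [integral_sq_parityIntegral]
  have h := intervalIntegral.norm_integral_le_of_norm_le_const (a := 0) (b := (t₁ : ℝ))
    (C := 2 / (m + 1)) (f := fun t => ∫ u in (0 : ℝ)..t₁, (1 - 2 * |t - u|) ^ m) fun t ht => by
      rw [Set.uIoc_of_le t₁.2.1] at ht
      exact abs_integral_one_sub_two_mul_abs_pow_le m t₁ ⟨ht.1.le, ht.2⟩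
  refine (le_abs_self _).trans (h.trans ?_)
  rw [sub_zero, abs_of_nonneg t₁.2.1]
  exact mul_le_of_le_one_right (by positivity) t₁.2.2

/-! ### Mean and variance of the marginal values -/

theorem potential_minReward (t₁ : unitInterval) : potential minReward t₁ = (t₁ : ℝ) / 2 := by
  have : IsGreatest (Set.range fun t' => minReward t₁ t') (t₁ : ℝ) :=
    ⟨⟨1, by simpa [minReward] using t₁.2.2⟩, by rintro _ ⟨t', rfl⟩; exact min_le_left _ _⟩
  rw [potential, iSup, this.csSup_eq]

/-- The marginal loss (`σ = -1 / 2`) and the marginal gain (`σ = 1 / 2`) are both of the form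
`c + σ D`, so their means deviate from `c` by half the mean of `D` in absolute value, and both
have a quarter of the variance of `D`. -/
theorem mean_variance_bounds_of_eq_add_mul {Ω : Type*} [MeasurableSpace Ω] {P : Measure Ω}
    [IsProbabilityMeasure P] {D : Ω → ℝ} {c ε : ℝ} (hD : MemLp D 2 P)
    (hmean : |∫ ω, D ω ∂P| ≤ ε) (hsq : ∫ ω, D ω ^ 2 ∂P ≤ 2 * ε) {σ : ℝ} (hσ : |σ| = 1 / 2)
    {F : Ω → ℝ} (hF : ∀ ω, F ω = c + σ * D ω) :
    MemLp F 2 P ∧ |(∫ ω, F ω ∂P) - c| ≤ ε / 2 ∧ variance F P = variance D P / 4 ∧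
      variance F P ≤ ε / 2 := by
  obtain rfl : F = fun ω => c + σ * D ω := funext hF
  have hσD : MemLp (fun ω => σ * D ω) 2 P := hD.const_mul σ
  have hvar : variance (fun ω => c + σ * D ω) P = variance D P / 4 := by
    rw [variance_const_add hσD.aestronglyMeasurable, variance_const_mul, ← sq_abs, hσ]
    ring
  refine ⟨(memLp_const c).add hσD, ?_, hvar, ?_⟩
  · rw [integral_add (integrable_const c) (hσD.integrable one_le_two), integral_const,
      integral_const_mul, probReal_univ, one_smul, add_sub_cancel_left, abs_mul, hσ]
    linarith
  · have h := (variance_le_expectation_sq hD.aestronglyMeasurable).trans hsq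
    rw [hvar]
    linarith

/-- The instance has `n = m + 1 ≥ 2` jobs: job `0` has the fixed type `t₁`, and the other `m` jobs
have independent types `X i`, each uniform on `[0, 1]` (`volume` on `unitInterval` is Lebesgue
measure on `[0, 1]`). The constant `C` depends on nothing. -/
theorem mainTheorem7 :
    ∃ C : ℝ, ∀ (m : ℕ), 2 ≤ m + 1 → ∀ (t₁ : unitInterval)
      (Ω : Type*) [MeasurableSpace Ω] (P : Measure Ω) [IsProbabilityMeasure P]
      (X : Fin m → Ω → unitInterval),
      iIndepFun X P →
      (∀ i, HasLaw (X i) (volume : Measure unitInterval) P) →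
      potential minReward t₁ = (t₁ : ℝ) / 2 ∧
      MemLp (fun ω => marginalLoss minReward (withFirstJob t₁ (fun i => X i ω)) 0) 2 P ∧
      MemLp (fun ω => marginalGain minReward (withFirstJob t₁ (fun i => X i ω)) 0) 2 P ∧
      |(∫ ω, marginalLoss minReward (withFirstJob t₁ (fun i => X i ω)) 0 ∂P)
        - potential minReward t₁| ≤ C / ((m + 1 : ℕ) : ℝ) ∧
      |(∫ ω, marginalGain minReward (withFirstJob t₁ (fun i => X i ω)) 0 ∂P)
        - potential minReward t₁| ≤ C / ((m + 1 : ℕ) : ℝ) ∧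
      variance (fun ω => marginalLoss minReward (withFirstJob t₁ (fun i => X i ω)) 0) P
        = variance (fun ω => marginalGain minReward (withFirstJob t₁ (fun i => X i ω)) 0) P ∧
      variance (fun ω => marginalLoss minReward (withFirstJob t₁ (fun i => X i ω)) 0) P
        ≤ C / ((m + 1 : ℕ) : ℝ) ∧
      variance (fun ω => marginalGain minReward (withFirstJob t₁ (fun i => X i ω)) 0) P
        ≤ C / ((m + 1 : ℕ) : ℝ) := by
  refine ⟨1 / 2, fun m _ t₁ Ω _ P _ X hindep hlaw => ?_⟩
  have hX : HasLaw (fun ω i => X i ω) (volume : Measure (Fin m → unitInterval)) P :=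
    hindep.hasLaw_pi hlaw
  have hmeas := measurable_parityIntegral m t₁.2.1
  have hDLp : MemLp (fun ω => parityIntegral t₁ fun i => X i ω) 2 P :=
    MemLp.of_bound (hmeas.comp_aemeasurable hX.aemeasurable).aestronglyMeasurable 1
      (Filter.Eventually.of_forall fun ω => abs_parityIntegral_le t₁ _)
  have hmean : |∫ ω, parityIntegral t₁ (fun i => X i ω) ∂P| ≤ 1 / (m + 1) := by
    have h := hX.integral_comp hmeas.aestronglyMeasurable
    simp only [Function.comp_def] at h
    rw [h]
    exact abs_integral_parityIntegral_le m t₁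
  have hsq : ∫ ω, parityIntegral t₁ (fun i => X i ω) ^ 2 ∂P ≤ 2 * (1 / (m + 1)) := by
    have h := hX.integral_comp (hmeas.pow_const 2).aestronglyMeasurable
    simp only [Function.comp_def] at h
    rw [h, mul_one_div]
    exact integral_sq_parityIntegral_le m t₁
  obtain ⟨hL, hL', hL'', hL'''⟩ := mean_variance_bounds_of_eq_add_mul hDLp hmean hsq
    (c := (t₁ : ℝ) / 2) (σ := -1 / 2) (by norm_num)
    (F := fun ω => marginalLoss minReward (withFirstJob t₁ (fun i => X i ω)) 0)
    fun ω => by rw [marginalLoss_withFirstJob]; ring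
  obtain ⟨hG, hG', hG'', hG'''⟩ := mean_variance_bounds_of_eq_add_mul hDLp hmean hsq
    (c := (t₁ : ℝ) / 2) (σ := 1 / 2) (by norm_num)
    (F := fun ω => marginalGain minReward (withFirstJob t₁ (fun i => X i ω)) 0)
    fun ω => by rw [marginalGain_withFirstJob]; ring
  have hC : (1 / 2 : ℝ) / ((m + 1 : ℕ) : ℝ) = 1 / (m + 1) / 2 := by
    push_cast
    ring
  rw [potential_minReward, hC]
  exact ⟨rfl, hL, hG, hL', hG', hL''.trans hG''.symm, hL''', hG'''⟩
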